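/- Let $m,T,N\ge 1$ be integers, let $X_1,\dots,X_N\in\mathbb R^{m\times T}$ be given nonrandom matrices, and for $A\in\mathbb R^{m\times T}$ let $\mathbb P_A$ be the distribution of $(Y_1,\dots,Y_N)$, where $Y_i=\operatorname{tr}(X_i^\top A)+\xi_i$ and $\xi_1,\dots,\xi_N$ are i.i.d. $\mathcal N(0,\sigma^2)$ random variables, $\sigma>0$. Write $\mathcal L(A)=N^{-1/2}(\operatorname{tr}(X_1^\top A),\dots,\operatorname{tr}(X_N^\top A))\in\mathbb R^N$, $|\cdot|_2$ for the Euclidean norm, $\hat d_{2,N}(A,B)=|\mathcal L(A-B)|_2$, and $\|A\|_{S_p}=\bigl(\sum_{j=1}^{\min(m,T)}\sigma_j(A)^p\bigr)^{1/p}$ for $0<p<\infty$, where $\sigma_1(A)\ge\sigma_2(A)\ge\dots$ are the singular values of $A$ (so $\|\cdot\|_{S_2}$ is the Frobenius norm). Let $M=\max(m,T)\ge 8$, let $r$ be an integer with $1\le r\le\min(m,T)$, and let $\nu>0$ and $\delta_r\in(0,1)$. Consider the restricted isometry condition $$(1-\delta_r)\|A\|_{S_2}\le \nu|\mathcal L(A)|_2\le(1+\delta_r)\|A\|_{S_2}\quad\text{for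 all } A\in\mathbb R^{m\times T}\text{ with }\operatorname{rank}(A)\le r. \tag{RI}$$ For $p\in(0,2]$, $\Delta>0$ and $0<\alpha<1/8$ put $$\psi=\min\Bigl(\frac{rM}{N},\ \Delta^p\Bigl(\frac MN\Bigr)^{1-p/2},\ \Delta^2\Bigr),\qquad C(\alpha)=\frac{\alpha(1-\delta_r)^2}{2^{2/p}(1+\delta_r)^2}\,\frac{\log 2}{128},\qquad C(\alpha,\nu)=\frac{\alpha}{2^{2/p}(1+\delta_r)^2}\,\frac{\log 2}{128}\,\nu^2 .$$ Then there is a universal function $\beta=\beta(M,\alpha)$ (depending on $M$ and $\alpha$ only, and not on $m,T,N,X_1,\dots,X_N,\sigma,r,\nu,\delta_r,p,\Delta$), with $\beta(M,\alpha)>0$ whenever $M\ge 8$ and $0<\alpha<1/8$ and $\beta(M,\alpha)\to1$ as $M\to\infty$, $\alpha\to0$, such that the following holds for all $p\in(0,2]$, $\Delta>0$ and $0<\alpha<1/8$, where $\inf_{\hat A}$ is over all estimators, that is, measurable functions $\hat A$ of $(Y_1,\dots,Y_N)$ with values in $\mathbb R^{m\times T}$. (i) If the right-hand inequality in (RI)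 holds, then $$\inf_{\hat A}\ \sup_{\operatorname{rank}(A^*)\le r,\ \|A^*\|_{S_p}\le\Delta\nu\sigma}\mathbb P_{A^*}\bigl(\|\hat A-A^*\|_{S_2}^2> C(\alpha,\nu)\,\sigma^2\psi\bigr)\ \ge\ \beta(M,\alpha).$$ (ii) If both inequalities in (RI) hold, then, with the same $\beta$, $$\inf_{\hat A}\ \sup_{\operatorname{rank}(A^*)\le r,\ \|A^*\|_{S_p}\le\Delta\nu\sigma}\mathbb P_{A^*}\bigl(\hat d_{2,N}(\hat A,A^*)^2> C(\alpha)\,\sigma^2\psi\bigr)\ \ge\ \beta(M,\alpha).$$ -/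

import Mathlib

open MeasureTheory ProbabilityTheory Filter Topology
open scoped ENNReal

noncomputable section

namespace TraceRegression

/-- `A ↦ (tr(X₁ᵀA), …, tr(X_NᵀA)) / √N`, with values in Euclidean space. -/
def samplingOperator {m T N : ℕ} (X : Fin N → Matrix (Fin m) (Fin T) ℝ) :
    Matrix (Fin m) (Fin T) ℝ →ₗ[ℝ] EuclideanSpace ℝ (Fin N) where
  toFun A := WithLp.toLp 2 fun i => ((X i).transpose * A).trace / √(N : ℝ)
  map_add' A B := by
    ext i
    simp [Matrix.mul_add, Matrix.trace_add, add_div]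
  map_smul' c A := by
    ext i
    simp [Matrix.mul_smul, Matrix.trace_smul, mul_div_assoc]

/-- The `j`-th largest singular value of `A`, with `j` counted from `0`. -/
def singularValue {m T : ℕ} (A : Matrix (Fin m) (Fin T) ℝ) (j : ℕ) : ℝ :=
  (Matrix.toEuclideanLin A).singularValues j

/-- The Schatten (quasi-)norm `‖A‖_{S_p}` for `0 < p < ∞`. -/
def schattenNorm {m T : ℕ} (p : ℝ) (A : Matrix (Fin m) (Fin T) ℝ) : ℝ :=
  (∑ j ∈ Finset.range (min m T), singularValue A j ^ p) ^ (1 / p)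

/-- The prediction distance `|𝓛(A - B)|₂`. -/
def predictionDist {m T N : ℕ} (X : Fin N → Matrix (Fin m) (Fin T) ℝ)
    (A B : Matrix (Fin m) (Fin T) ℝ) : ℝ :=
  ‖samplingOperator X (A - B)‖

/-- The right-hand inequality of the restricted isometry condition with constant `δ`. -/
def RIUpper {m T N : ℕ} (X : Fin N → Matrix (Fin m) (Fin T) ℝ) (r : ℕ) (ν δ : ℝ) : Prop :=
  ∀ A : Matrix (Fin m) (Fin T) ℝ, A.rank ≤ r →
    ν * ‖samplingOperator X A‖ ≤ (1 + δ) * schattenNorm 2 A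

/-- The left-hand inequality of the restricted isometry condition with constant `δ`. -/
def RILower {m T N : ℕ} (X : Fin N → Matrix (Fin m) (Fin T) ℝ) (r : ℕ) (ν δ : ℝ) : Prop :=
  ∀ A : Matrix (Fin m) (Fin T) ℝ, A.rank ≤ r →
    (1 - δ) * schattenNorm 2 A ≤ ν * ‖samplingOperator X A‖

/-- The restricted isometry condition `RI(r, ν)` with constant `δ`. -/
def RI {m T N : ℕ} (X : Fin N → Matrix (Fin m) (Fin T) ℝ) (r : ℕ) (ν δ : ℝ) : Prop :=
  RILower X r ν δ ∧ RIUpper X r ν δ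

/-- The observations `Y_i = tr(X_iᵀ A) + ξ_i`. -/
def observations {m T N : ℕ} {Ω : Type*} (X : Fin N → Matrix (Fin m) (Fin T) ℝ)
    (ξ : Fin N → Ω → ℝ) (A : Matrix (Fin m) (Fin T) ℝ) (ω : Ω) : Fin N → ℝ :=
  fun i => ((X i).transpose * A).trace + ξ i ω

/-- The distribution `ℙ_A` of `(Y₁, …, Y_N)` when the true matrix is `A`. -/
def obsLaw {m T N : ℕ} {Ω : Type*} [MeasurableSpace Ω] (P : Measure Ω)
    (X : Fin N → Matrix (Fin m) (Fin T) ℝ) (ξ : Fin N → Ω → ℝ)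
    (A : Matrix (Fin m) (Fin T) ℝ) : Measure (Fin N → ℝ) :=
  P.map (observations X ξ A)

/-- Estimators: measurable functions of the data `(Y₁, …, Y_N)` with values in matrices
(the `X_i` are nonrandom and known). -/
def IsEstimator {m T N : ℕ} (Ahat : (Fin N → ℝ) → Matrix (Fin m) (Fin T) ℝ) : Prop :=
  ∀ i j, Measurable fun y => Ahat y i j

/-- Matrices of rank at most `r` whose Schatten-`p` (quasi-)norm is at most `R`. -/
def matrixClass (m T r : ℕ) (p R : ℝ) : Set (Matrix (Fin m) (Fin T) ℝ) :=
  {A | A.rank ≤ r ∧ schattenNorm p A ≤ R}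

/-- `min(rM/N, Δ^p (M/N)^(1 - p/2), Δ²)`. -/
def rate (M N r : ℕ) (p Δ : ℝ) : ℝ :=
  min ((r : ℝ) * M / N) (min (Δ ^ p * ((M : ℝ) / N) ^ (1 - p / 2)) (Δ ^ 2))

/-- The constant `C(α)` of the prediction bound. -/
def predConst (α δ p : ℝ) : ℝ :=
  α * (1 - δ) ^ 2 / ((2 : ℝ) ^ (2 / p) * (1 + δ) ^ 2) * (Real.log 2 / 128)

/-- The constant `C(α, ν)` of the Frobenius bound. -/
def frobConst (α δ p ν : ℝ) : ℝ :=
  α / ((2 : ℝ) ^ (2 / p) * (1 + δ) ^ 2) * (Real.log 2 / 128) * ν ^ 2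

end TraceRegression

end

namespace TraceRegression

/-! Take a block `J` of `s` full rows or columns of length `M = max m T`, and put a value `a` on an
arbitrary subset `S` of `J`, zero elsewhere. These `2^|J|` matrices and all their differences have
rank at most `s ≤ r`, so the isometry condition at rank `r` suffices. `exists_rank_level` gives `s`
and the scale of `a` for which the matrices lie in the class while `a² |J|` is at least 32 times the
squared Frobenius error to be excluded.

No packing is extracted: all subsets are kept. An estimate good for both `S` and `U` forces `|S ∆ U|
≤ |J|/8`, so by `card_symmDiff_ball_le` it is good for at most `2^(7|J|/8)` subsets. Averaging under
the pure noise law yields an `S` for which success has null probability at most `2^(-|J|/8)`.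
Cauchy–Schwarz against the likelihood ratio (`obsLaw_sq_le`) transfers this to the law of the true
matrix: the squared success probability is at most `2^(|J|/32)` times the null one. Hence success
has probability at most `2^(-3|J|/64) ≤ 2^(-3M/64)`, and `β = 1 - 2^(-3M/64)` serves for every `α`.

Both losses are norms of a linear image of the error, bounded below by a multiple of the Frobenius
norm on low rank, so one argument covers them. -/

/-! ### Singular values and Schatten norms -/

lemma singularValue_nonneg {m T : ℕ} (A : Matrix (Fin m) (Fin T) ℝ) (j : ℕ) :
    0 ≤ singularValue A j :=
  LinearMap.singularValues_nonneg _ j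

lemma singularValue_eq_zero_of_rank_le {m T : ℕ} (A : Matrix (Fin m) (Fin T) ℝ) {j : ℕ}
    (h : A.rank ≤ j) : singularValue A j = 0 := by
  rw [singularValue, LinearMap.singularValues_eq_zero_iff_le_finrank_range]
  refine le_trans (le_of_eq ?_) h
  rw [Matrix.rank_eq_finrank_range_toLin A (PiLp.basisFun 2 ℝ (Fin m)) (PiLp.basisFun 2 ℝ (Fin T)),
    ← Matrix.toLpLin_eq_toLin]

/-- Both sides are the trace of `L.adjoint ∘ₗ L`, computed from its eigenvalues and in the standard
basis. -/
lemma sum_singularValue_sq {m T : ℕ} (A : Matrix (Fin m) (Fin T) ℝ) :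
    ∑ j ∈ Finset.range (min m T), singularValue A j ^ 2 = ∑ i, ∑ j, A i j ^ 2 := by
  have hsub : ∑ j ∈ Finset.range (min m T), singularValue A j ^ 2
      = ∑ j ∈ Finset.range T, singularValue A j ^ 2 := by
    refine Finset.sum_subset (by simp) fun j hj hj' => ?_
    rw [singularValue_eq_zero_of_rank_le, zero_pow two_ne_zero]
    refine A.rank_le_height.trans ?_
    simp only [Finset.mem_range] at hj hj'
    omega
  have hT : Module.finrank ℝ (EuclideanSpace ℝ (Fin T)) = T := finrank_euclideanSpace_fin
  set L := Matrix.toEuclideanLin A with hL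
  rw [hsub, Finset.sum_range]
  calc ∑ j : Fin T, singularValue A j ^ 2
      = ∑ j, L.isSymmetric_adjoint_comp_self.eigenvalues hT j :=
        Finset.sum_congr rfl fun j _ => L.sq_singularValues_fin hT j
    _ = LinearMap.trace ℝ _ (L.adjoint ∘ₗ L) :=
        (L.isSymmetric_adjoint_comp_self.trace_eq_sum_eigenvalues hT).symm
    _ = ∑ j, ‖L (EuclideanSpace.basisFun (Fin T) ℝ j)‖ ^ 2 := by
        rw [LinearMap.trace_eq_sum_inner _ (EuclideanSpace.basisFun (Fin T) ℝ)]
        refine Finset.sum_congr rfl fun j _ => ?_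
        rw [LinearMap.comp_apply, LinearMap.adjoint_inner_right, real_inner_self_eq_norm_sq]
    _ = ∑ j, ∑ i, A i j ^ 2 := by
        refine Finset.sum_congr rfl fun j _ => ?_
        rw [EuclideanSpace.real_norm_sq_eq]
        simp [hL, Matrix.toLpLin_apply]
    _ = _ := Finset.sum_comm

lemma schattenNorm_nonneg {m T : ℕ} (p : ℝ) (A : Matrix (Fin m) (Fin T) ℝ) :
    0 ≤ schattenNorm p A :=
  Real.rpow_nonneg (Finset.sum_nonneg fun j _ => Real.rpow_nonneg (singularValue_nonneg A j) _) _

/-- The Schatten `2`-norm is the Frobenius norm. -/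
lemma schattenNorm_two_sq {m T : ℕ} (A : Matrix (Fin m) (Fin T) ℝ) :
    schattenNorm 2 A ^ 2 = ∑ i, ∑ j, A i j ^ 2 := by
  have h : 0 ≤ ∑ i, ∑ j, A i j ^ 2 := by positivity
  rw [schattenNorm, ← Real.sqrt_eq_rpow]
  simp_rw [Real.rpow_two]
  rw [sum_singularValue_sq, Real.sq_sqrt h]

/-- Power mean inequality with exponent `2 / p ≥ 1`, applied to the `p`-th powers of the first `s`
singular values; the others vanish. -/
lemma schattenNorm_le_of_rank_le {m T s : ℕ} {p : ℝ} (hp : 0 < p) (hp2 : p ≤ 2)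
    (A : Matrix (Fin m) (Fin T) ℝ) (hA : A.rank ≤ s) :
    schattenNorm p A ≤ (s : ℝ) ^ (1 / p - 1 / 2) * schattenNorm 2 A := by
  have hset : ∀ q : ℝ, 0 < q → ∑ j ∈ Finset.range (min m T), singularValue A j ^ q
      = ∑ j ∈ Finset.range s, singularValue A j ^ q := by
    have key : ∀ q : ℝ, 0 < q → ∀ k, A.rank ≤ k → ∑ j ∈ Finset.range k, singularValue A j ^ q
        = ∑ j ∈ Finset.range A.rank, singularValue A j ^ q := by
      intro q hq k hk
      symm
      refine Finset.sum_subset (by simpa using hk) fun j _ hj' => ?_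
      rw [singularValue_eq_zero_of_rank_le A (by simpa using hj'), Real.zero_rpow hq.ne']
    intro q hq
    rw [key q hq _ (le_min A.rank_le_height A.rank_le_width), key q hq s hA]
  have hnn : ∀ q : ℝ, 0 ≤ ∑ j ∈ Finset.range s, singularValue A j ^ q := fun q =>
    Finset.sum_nonneg fun j _ => Real.rpow_nonneg (singularValue_nonneg A j) _
  have h := Real.rpow_sum_le_const_mul_sum_rpow_of_nonneg (Finset.range s)
    (f := fun j => singularValue A j ^ p) (p := 2 / p) (by rwa [le_div_iff₀ hp, one_mul])
    (fun j _ => Real.rpow_nonneg (singularValue_nonneg A j) _)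
  have h2 : ∀ j, (singularValue A j ^ p) ^ (2 / p) = singularValue A j ^ (2 : ℝ) := fun j => by
    rw [← Real.rpow_mul (singularValue_nonneg A j), mul_div_cancel₀ _ hp.ne']
  simp_rw [h2] at h
  rw [Finset.card_range] at h
  have h3 := Real.rpow_le_rpow (Real.rpow_nonneg (hnn p) _) h (by norm_num : (0 : ℝ) ≤ 1 / 2)
  rw [← Real.rpow_mul (hnn p), Real.mul_rpow (by positivity) (hnn 2),
    ← Real.rpow_mul (Nat.cast_nonneg s)] at h3
  rw [schattenNorm, schattenNorm, hset p hp, hset 2 two_pos]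
  convert h3 using 2
  · ring
  · congr 1; ring

/-! ### Likelihood ratios of Gaussian products -/

lemma lintegral_pi_prod {ι : Type*} [Fintype ι] {α : ι → Type*} [∀ i, MeasurableSpace (α i)]
    (μ : ∀ i, Measure (α i)) [∀ i, IsProbabilityMeasure (μ i)] (f : ∀ i, α i → ℝ≥0∞)
    (hf : ∀ i, Measurable (f i)) :
    ∫⁻ y, ∏ i, f i (y i) ∂Measure.pi μ = ∏ i, ∫⁻ x, f i x ∂μ i := by
  rw [lintegral_prod_eq_prod_lintegral_of_indepFun Finset.univ
    (fun i (y : ∀ i, α i) => f i (y i))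
    (iIndepFun_pi fun i => (hf i).aemeasurable)
    fun i => (hf i).comp (measurable_pi_apply i)]
  exact Finset.prod_congr rfl fun i _ => (measurePreserving_eval μ i).lintegral_comp (hf i)

/-- A product of absolutely continuous probability measures has the product density. -/
lemma pi_withDensity {ι : Type*} [Fintype ι] {α : ι → Type*} [∀ i, MeasurableSpace (α i)]
    (μ : ∀ i, Measure (α i)) [∀ i, IsProbabilityMeasure (μ i)] (f : ∀ i, α i → ℝ≥0∞)
    (hf : ∀ i, Measurable (f i)) [∀ i, SigmaFinite ((μ i).withDensity (f i))] :
    Measure.pi (fun i => (μ i).withDensity (f i))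
      = (Measure.pi μ).withDensity fun y => ∏ i, f i (y i) := by
  refine Measure.pi_eq fun s hs => ?_
  rw [withDensity_apply _ (MeasurableSet.univ_pi hs),
    ← lintegral_indicator (MeasurableSet.univ_pi hs)]
  have hprod : ∀ y, (Set.univ.pi s).indicator (fun y => ∏ i, f i (y i)) y
      = ∏ i, (s i).indicator (f i) (y i) := by
    intro y
    by_cases hy : y ∈ Set.univ.pi s
    · rw [Set.indicator_of_mem hy]
      exact Finset.prod_congr rfl fun i _ => (Set.indicator_of_mem (hy i trivial) _).symm
    · rw [Set.indicator_of_notMem hy]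
      simp only [Set.mem_univ_pi, not_forall] at hy
      obtain ⟨i, hi⟩ := hy
      exact (Finset.prod_eq_zero (Finset.mem_univ i) (Set.indicator_of_notMem hi _)).symm
  simp_rw [hprod]
  have hm : ∀ i, Measurable ((s i).indicator (f i)) := fun i => (hf i).indicator (hs i)
  rw [lintegral_pi_prod μ _ hm]
  refine Finset.prod_congr rfl fun i _ => ?_
  rw [lintegral_indicator (hs i), withDensity_apply _ (hs i)]

/-- The likelihood ratio of `𝒩(μ, v)` against `𝒩(0, v)`. -/
noncomputable def gaussianRatio (μ v x : ℝ) : ℝ≥0∞ :=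
  ENNReal.ofReal (Real.exp ((μ * x - μ ^ 2 / 2) / v))

lemma measurable_gaussianRatio (μ v : ℝ) : Measurable (gaussianRatio μ v) := by
  unfold gaussianRatio; fun_prop

lemma gaussianReal_eq_withDensity_gaussianRatio (μ : ℝ) {v : NNReal} (hv : v ≠ 0) :
    gaussianReal μ v = (gaussianReal 0 v).withDensity (gaussianRatio μ v) := by
  have hv' : (v : ℝ) ≠ 0 := by exact_mod_cast hv
  rw [gaussianReal_of_var_ne_zero _ hv, gaussianReal_of_var_ne_zero _ hv,
    ← withDensity_mul _ (measurable_gaussianPDF _ _) (measurable_gaussianRatio _ _)]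
  congr 1
  ext x
  rw [Pi.mul_apply, gaussianPDF, gaussianPDF, gaussianRatio,
    ← ENNReal.ofReal_mul (gaussianPDFReal_nonneg _ _ _), gaussianPDFReal, gaussianPDFReal,
    mul_assoc (√(2 * Real.pi * v))⁻¹, ← Real.exp_add]
  congr 3
  field_simp
  ring

/-- The squared ratio is `exp(-μ²/v)` times `exp(2μx/v)`, and the Gaussian moment generating
function at `2μ/v` contributes `exp(2μ²/v)`. -/
lemma lintegral_gaussianRatio_sq (μ : ℝ) {v : NNReal} (hv : v ≠ 0) :
    ∫⁻ x, gaussianRatio μ v x ^ 2 ∂gaussianReal 0 v = ENNReal.ofReal (Real.exp (μ ^ 2 / v)) := by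
  have hv' : (v : ℝ) ≠ 0 := by exact_mod_cast hv
  have h : ∀ x, gaussianRatio μ v x ^ 2
      = ENNReal.ofReal (Real.exp (-(μ ^ 2 / v)) * Real.exp (2 * μ / v * x)) := by
    intro x
    rw [gaussianRatio, ← ENNReal.ofReal_pow (Real.exp_pos _).le, ← Real.exp_nat_mul,
      ← Real.exp_add]
    congr 2
    field_simp
    push_cast
    ring
  simp_rw [h]
  rw [← ofReal_integral_eq_lintegral_ofReal
    ((integrable_exp_mul_gaussianReal _).const_mul _) (ae_of_all _ fun x => by positivity),
    integral_const_mul]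
  have hm := congrFun (mgf_fun_id_gaussianReal (μ := 0) (v := v)) (2 * μ / v)
  rw [mgf] at hm
  rw [hm, ← Real.exp_add]
  congr 2
  field_simp
  ring

/-- Second-moment comparison of a shifted Gaussian product with the centered one. -/
lemma pi_gaussianReal_sq_le {N : ℕ} (μ : Fin N → ℝ) {v : NNReal} (hv : v ≠ 0)
    {E : Set (Fin N → ℝ)} (hE : MeasurableSet E) :
    (Measure.pi fun i => gaussianReal (μ i) v) E ^ 2
      ≤ ENNReal.ofReal (Real.exp ((∑ i, μ i ^ 2) / v))
        * (Measure.pi fun _ : Fin N => gaussianReal 0 v) E := by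
  set Q := Measure.pi fun _ : Fin N => gaussianReal 0 v with hQ
  set R : (Fin N → ℝ) → ℝ≥0∞ := fun y => ∏ i, gaussianRatio (μ i) v (y i) with hR
  have hmeas : Measurable R :=
    Finset.measurable_prod _ fun i _ => (measurable_gaussianRatio _ _).comp (measurable_pi_apply i)
  have hpi : (Measure.pi fun i => gaussianReal (μ i) v) = Q.withDensity R := by
    have hfam : (fun i => gaussianReal (μ i) v)
        = fun i => (gaussianReal 0 v).withDensity (gaussianRatio (μ i) v) :=
      funext fun i => gaussianReal_eq_withDensity_gaussianRatio (μ i) hv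
    have : ∀ i, SigmaFinite ((gaussianReal 0 v).withDensity (gaussianRatio (μ i) v)) := fun i => by
      rw [← gaussianReal_eq_withDensity_gaussianRatio (μ i) hv]; infer_instance
    rw [hfam]
    exact pi_withDensity (fun _ => gaussianReal 0 v) _ fun i => measurable_gaussianRatio _ _
  have hsq : ∫⁻ y, R y ^ 2 ∂Q = ENNReal.ofReal (Real.exp ((∑ i, μ i ^ 2) / v)) := by
    simp_rw [hR, ← Finset.prod_pow]
    rw [hQ, lintegral_pi_prod (fun _ => gaussianReal 0 v) (fun i x => gaussianRatio (μ i) v x ^ 2)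
      fun i => (measurable_gaussianRatio _ _).pow_const 2]
    simp_rw [lintegral_gaussianRatio_sq _ hv]
    rw [← ENNReal.ofReal_prod_of_nonneg fun i _ => (Real.exp_pos _).le, ← Real.exp_sum,
      Finset.sum_div]
  -- Cauchy–Schwarz for the density times the indicator of `E`.
  have hcs := ENNReal.lintegral_mul_le_Lp_mul_Lq Q Real.HolderConjugate.two_two
    hmeas.aemeasurable ((measurable_const (a := (1 : ℝ≥0∞))).indicator hE).aemeasurable
  have h1 : ∫⁻ y, (R * E.indicator fun _ => (1 : ℝ≥0∞)) y ∂Q = Q.withDensity R E := by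
    rw [withDensity_apply _ hE, ← lintegral_indicator hE]
    refine lintegral_congr fun y => ?_
    by_cases hy : y ∈ E <;> simp [hy]
  have h2 : ∫⁻ y, (E.indicator (fun _ => (1 : ℝ≥0∞)) y) ^ (2 : ℝ) ∂Q = Q E := by
    rw [← lintegral_indicator_one hE]
    refine lintegral_congr fun y => ?_
    by_cases hy : y ∈ E <;> simp [hy]
  rw [h1, h2] at hcs
  simp_rw [ENNReal.rpow_two] at hcs
  rw [hsq] at hcs
  rw [hpi]
  calc _ ≤ _ := pow_le_pow_left₀ zero_le hcs 2
    _ = _ := by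
      rw [mul_pow, ← ENNReal.rpow_two, ← ENNReal.rpow_two, ← ENNReal.rpow_mul, ← ENNReal.rpow_mul]
      norm_num

/-! ### Counting in the hypercube -/

/-- Hamming balls of relative radius `1/8` are exponentially small. -/
lemma card_symmDiff_ball_le {κ : Type*} [DecidableEq κ] (J S : Finset κ) (hS : S ⊆ J) :
    (((J.powerset.filter fun U => 8 * (symmDiff S U).card ≤ J.card).card : ℕ) : ℝ)
      ≤ (2 : ℝ) ^ (7 / 8 * (J.card : ℝ)) := by
  set F := J.powerset.filter fun U => 8 * (symmDiff S U).card ≤ J.card with hF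
  have hmaps : ∀ U ∈ J.powerset, symmDiff S U ∈ J.powerset := by
    intro U hU
    rw [Finset.mem_powerset] at hU ⊢
    exact (Finset.union_subset hS hU).trans' symmDiff_le_sup
  -- Chernoff weights: `U ↦ S ∆ U` is an involution of the power set, so the total weight is the
  -- binomial sum `(1/2 + 1)^|J|`.
  have hsum : ∑ U ∈ J.powerset, ((1 : ℝ) / 2) ^ (symmDiff S U).card = (3 / 2 : ℝ) ^ J.card := by
    have h := Finset.sum_pow_mul_eq_add_pow (1 / 2 : ℝ) 1 J
    simp only [one_pow, mul_one] at h
    rw [show (3 / 2 : ℝ) = 1 / 2 + 1 by norm_num, ← h]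
    exact Finset.sum_nbij' (fun U => symmDiff S U) (fun U => symmDiff S U) hmaps hmaps
      (fun U _ => symmDiff_symmDiff_cancel_left S U)
      (fun U _ => symmDiff_symmDiff_cancel_left S U) fun U _ => rfl
  have hlow : (F.card : ℝ) * (2 : ℝ) ^ (-(1 / 8) * (J.card : ℝ)) ≤ (3 / 2 : ℝ) ^ J.card := by
    rw [← hsum, ← nsmul_eq_mul, ← Finset.sum_const]
    refine (Finset.sum_le_sum fun U hU => ?_).trans
      (Finset.sum_le_sum_of_subset_of_nonneg (Finset.filter_subset _ _)
        fun U _ _ => by positivity)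
    rw [hF, Finset.mem_filter] at hU
    have hU' : (8 : ℝ) * (symmDiff S U).card ≤ J.card := by exact_mod_cast hU.2
    rw [one_div 2, inv_pow, ← Real.rpow_natCast, ← Real.rpow_neg two_pos.le]
    exact Real.rpow_le_rpow_of_exponent_le one_le_two (by linarith)
  -- Since `(3/2)^4 = 81/16 ≤ 2^3`; the final exponent is then `3/4 + 1/8 = 7/8`.
  have h32 : (3 / 2 : ℝ) ≤ 2 ^ (3 / 4 : ℝ) := by
    refine le_of_pow_le_pow_left₀ (n := 4) (by norm_num) (by positivity) ?_
    rw [← Real.rpow_natCast, ← Real.rpow_natCast, ← Real.rpow_mul two_pos.le]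
    norm_num
  have h32' : (3 / 2 : ℝ) ^ J.card ≤ (2 : ℝ) ^ (3 / 4 * (J.card : ℝ)) := by
    rw [Real.rpow_mul two_pos.le, Real.rpow_natCast]
    exact pow_le_pow_left₀ (by norm_num) h32 _
  have h := hlow.trans h32'
  rw [← le_div_iff₀ (by positivity), ← Real.rpow_sub two_pos] at h
  refine h.trans (le_of_eq ?_)
  congr 1
  ring

/-! ### The law of the observations -/

lemma norm_samplingOperator_sq {m T N : ℕ} (hN : 1 ≤ N) (X : Fin N → Matrix (Fin m) (Fin T) ℝ)
    (A : Matrix (Fin m) (Fin T) ℝ) :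
    ∑ i, ((X i).transpose * A).trace ^ 2 = N * ‖samplingOperator X A‖ ^ 2 := by
  have hN' : (0 : ℝ) < N := by exact_mod_cast hN
  rw [EuclideanSpace.real_norm_sq_eq, Finset.mul_sum]
  refine Finset.sum_congr rfl fun i _ => ?_
  simp only [samplingOperator, LinearMap.coe_mk, AddHom.coe_mk]
  rw [div_pow, Real.sq_sqrt hN'.le]
  field_simp

lemma obsLaw_eq_pi {m T N : ℕ} {Ω : Type*} [MeasurableSpace Ω] (P : Measure Ω)
    (X : Fin N → Matrix (Fin m) (Fin T) ℝ) {ξ : Fin N → Ω → ℝ} {v : NNReal}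
    (hind : iIndepFun ξ P) (hlaw : ∀ i, HasLaw (ξ i) (gaussianReal 0 v) P)
    (A : Matrix (Fin m) (Fin T) ℝ) :
    obsLaw P X ξ A = Measure.pi fun i => gaussianReal ((X i).transpose * A).trace v := by
  have h := iIndepFun.hasLaw_pi (P := P)
    (X := fun i ω => ((X i).transpose * A).trace + ξ i ω)
    (μ := fun i => gaussianReal ((X i).transpose * A).trace v)
    (fun i => by simpa using (gaussianReal_const_add (hlaw i) ((X i).transpose * A).trace))
    (hind.comp (fun i x => ((X i).transpose * A).trace + x) fun i => by fun_prop)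
  exact h.map_eq

lemma obsLaw_sq_le {m T N : ℕ} {Ω : Type*} [MeasurableSpace Ω] (P : Measure Ω)
    (X : Fin N → Matrix (Fin m) (Fin T) ℝ) {ξ : Fin N → Ω → ℝ} {σ : ℝ} (hN : 1 ≤ N) (hσ : 0 < σ)
    (hind : iIndepFun ξ P)
    (hlaw : ∀ i, HasLaw (ξ i) (gaussianReal 0 (Real.toNNReal (σ ^ 2))) P)
    (A : Matrix (Fin m) (Fin T) ℝ) {E : Set (Fin N → ℝ)} (hE : MeasurableSet E) :
    obsLaw P X ξ A E ^ 2
      ≤ ENNReal.ofReal (Real.exp (N * ‖samplingOperator X A‖ ^ 2 / σ ^ 2)) * obsLaw P X ξ 0 E := by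
  have hv : Real.toNNReal (σ ^ 2) ≠ 0 := by
    rw [Ne, Real.toNNReal_eq_zero]
    exact not_le.mpr (by positivity)
  have h := pi_gaussianReal_sq_le (fun i => ((X i).transpose * A).trace) hv hE
  rw [norm_samplingOperator_sq hN, Real.coe_toNNReal _ (by positivity)] at h
  rw [obsLaw_eq_pi P X hind hlaw, obsLaw_eq_pi P X hind hlaw]
  simpa using h

lemma isProbabilityMeasure_obsLaw {m T N : ℕ} {Ω : Type*} [MeasurableSpace Ω] (P : Measure Ω)
    (X : Fin N → Matrix (Fin m) (Fin T) ℝ) {ξ : Fin N → Ω → ℝ} {v : NNReal}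
    (hind : iIndepFun ξ P) (hlaw : ∀ i, HasLaw (ξ i) (gaussianReal 0 v) P)
    (A : Matrix (Fin m) (Fin T) ℝ) : IsProbabilityMeasure (obsLaw P X ξ A) := by
  rw [obsLaw_eq_pi P X hind hlaw]
  infer_instance

/-! ### Averaging, pattern matrices and parameter choice -/

/-- If every point lies in at most `V` of the sets `G w`, some `G w` has measure at most
`V / #W`. -/
lemma exists_measureReal_mul_card_le {Y κ : Type*} [MeasurableSpace Y] (Q : Measure Y)
    [IsProbabilityMeasure Q] {W : Finset κ} (hW : W.Nonempty) (G : κ → Set Y)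
    (hG : ∀ w ∈ W, MeasurableSet (G w)) {V : ℝ}
    (hV : ∀ y, ∑ w ∈ W, (G w).indicator (1 : Y → ℝ) y ≤ V) :
    ∃ w ∈ W, Q.real (G w) * W.card ≤ V := by
  have hint : ∀ w ∈ W, Integrable ((G w).indicator (1 : Y → ℝ)) Q := fun w hw =>
    (integrable_const (1 : ℝ)).indicator (hG w hw)
  have hsum : ∑ w ∈ W, Q.real (G w) ≤ V := by
    calc ∑ w ∈ W, Q.real (G w) = ∑ w ∈ W, ∫ y, (G w).indicator (1 : Y → ℝ) y ∂Q :=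
          Finset.sum_congr rfl fun w hw => (integral_indicator_one (hG w hw)).symm
      _ = ∫ y, ∑ w ∈ W, (G w).indicator (1 : Y → ℝ) y ∂Q := (integral_finsetSum _ hint).symm
      _ ≤ ∫ _, V ∂Q := integral_mono (integrable_finsetSum _ hint) (integrable_const _) hV
      _ = V := by simp
  have hcard : (0 : ℝ) < W.card := by exact_mod_cast hW.card_pos
  obtain ⟨w, hw, h⟩ := Finset.exists_le_of_sum_le hW (f := fun w => Q.real (G w))
    (g := fun _ => V / W.card) (by
      rw [Finset.sum_const, nsmul_eq_mul, mul_div_cancel₀ _ hcard.ne']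
      exact hsum)
  exact ⟨w, hw, (le_div_iff₀ hcard).mp h⟩

/-- The matrix equal to `a` on `S` and zero elsewhere. -/
noncomputable def patternMatrix {m T : ℕ} (a : ℝ) (S : Finset (Fin m × Fin T)) :
    Matrix (Fin m) (Fin T) ℝ :=
  Matrix.of fun i j => if (i, j) ∈ S then a else 0

lemma schattenNorm_two_sq_patternMatrix_sub {m T : ℕ} (a : ℝ) (S U : Finset (Fin m × Fin T)) :
    schattenNorm 2 (patternMatrix a S - patternMatrix a U) ^ 2
      = a ^ 2 * (symmDiff S U).card := by
  rw [schattenNorm_two_sq, ← Fintype.sum_prod_type' (f := fun i j =>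
    (patternMatrix a S - patternMatrix a U) i j ^ 2), mul_comm, ← nsmul_eq_mul,
    ← Finset.sum_const, ← Finset.sum_subset (Finset.subset_univ (symmDiff S U))]
  · refine Finset.sum_congr rfl fun x hx => ?_
    rw [Finset.mem_symmDiff] at hx
    rcases hx with ⟨h1, h2⟩ | ⟨h1, h2⟩ <;> simp [patternMatrix, h1, h2]
  · intro x _ hx
    rw [Finset.mem_symmDiff] at hx
    by_cases h1 : x ∈ S <;> by_cases h2 : x ∈ U <;> simp_all [patternMatrix]

lemma patternMatrix_empty {m T : ℕ} (a : ℝ) :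
    patternMatrix a (∅ : Finset (Fin m × Fin T)) = 0 := by
  ext i j
  simp [patternMatrix]

lemma schattenNorm_two_sq_patternMatrix {m T : ℕ} (a : ℝ) (S : Finset (Fin m × Fin T)) :
    schattenNorm 2 (patternMatrix a S) ^ 2 = a ^ 2 * S.card := by
  have h := schattenNorm_two_sq_patternMatrix_sub a S ∅
  rw [patternMatrix_empty, sub_zero] at h
  rw [h, ← Finset.bot_eq_empty, symmDiff_bot]

/-- A block of `s` full rows or columns of length `max m T`. -/
lemma exists_block {m T s : ℕ} (hs : s ≤ min m T) :
    ∃ J : Finset (Fin m × Fin T), J.card = s * max m T ∧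
      ∀ A : Matrix (Fin m) (Fin T) ℝ, (∀ i j, (i, j) ∉ J → A i j = 0) → A.rank ≤ s := by
  have hsm : s ≤ m := hs.trans (min_le_left _ _)
  have hsT : s ≤ T := hs.trans (min_le_right _ _)
  -- Rows only; the case of columns follows by transposition.
  have hrows : ∀ {a b : ℕ} (_ : s ≤ a) (A : Matrix (Fin a) (Fin b) ℝ),
      (∀ (i : Fin a) (j : Fin b), s ≤ (i : ℕ) → A i j = 0) → A.rank ≤ s := by
    intro a b hsa A hA
    have hc : ((Finset.univ : Finset (Fin s)).map (Fin.castLEEmb hsa)).card = s := by simp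
    rw [← hc]
    refine A.rank_le_card_of_support_subset _ ?_
    intro i hi
    by_contra hcon
    refine hi (funext fun j => hA i j ?_)
    by_contra hlt
    exact hcon (by simpa using hlt)
  rcases le_total T m with h | h
  · refine ⟨(Finset.univ : Finset (Fin m)) ×ˢ
      (Finset.univ : Finset (Fin s)).map (Fin.castLEEmb hsT), ?_, fun A hA => ?_⟩
    · simp [max_eq_left h, mul_comm]
    · rw [← Matrix.rank_transpose]
      refine hrows hsT _ fun j i hj => hA i j fun hmem => ?_
      simp only [Finset.mem_product, Finset.mem_univ, Finset.mem_map, true_and] at hmem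
      obtain ⟨k, hk⟩ := hmem
      have := k.isLt
      rw [← hk] at hj
      simp at hj
      omega
  · refine ⟨(Finset.univ : Finset (Fin s)).map (Fin.castLEEmb hsm) ×ˢ
      (Finset.univ : Finset (Fin T)), ?_, fun A hA => ?_⟩
    · simp [max_eq_right h]
    · refine hrows hsm _ fun i j hi => hA i j fun hmem => ?_
      simp only [Finset.mem_product, Finset.mem_univ, Finset.mem_map, true_and, and_true] at hmem
      obtain ⟨k, hk⟩ := hmem
      have := k.isLt
      rw [← hk] at hi
      simp at hi
      omega

/-- Expanding `L` in matrix units reduces this to entrywise measurability. -/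
lemma IsEstimator.measurable_norm {m T N : ℕ} {F : Type*} [NormedAddCommGroup F]
    [NormedSpace ℝ F] [FiniteDimensional ℝ F]
    {Ahat : (Fin N → ℝ) → Matrix (Fin m) (Fin T) ℝ} (h : IsEstimator Ahat)
    (L : Matrix (Fin m) (Fin T) ℝ →ₗ[ℝ] F) (A : Matrix (Fin m) (Fin T) ℝ) :
    Measurable fun y => ‖L (Ahat y - A)‖ := by
  borelize F
  have := FiniteDimensional.proper_real F
  refine Measurable.norm ?_
  have hL : ∀ B : Matrix (Fin m) (Fin T) ℝ, L B = ∑ i, ∑ j, B i j • L (Matrix.single i j 1) := by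
    intro B
    conv_lhs => rw [Matrix.matrix_eq_sum_single B]
    simp only [map_sum]
    refine Finset.sum_congr rfl fun i _ => Finset.sum_congr rfl fun j _ => ?_
    rw [← map_smul, Matrix.smul_single, smul_eq_mul, mul_one]
  have hexp : (fun y => L (Ahat y - A))
      = fun y => ∑ i, ∑ j, (Ahat y i j - A i j) • L (Matrix.single i j 1) :=
    funext fun y => hL _
  rw [hexp]
  refine Finset.measurable_sum _ fun i _ => Finset.measurable_sum _ fun j _ => ?_
  exact ((h i j).sub_const _).smul_const _

/-- Choice of the number `s` of active columns and of the signal level `t`. -/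
lemma exists_rank_level {M N r : ℕ} {p Δ : ℝ} (hM : 1 ≤ M) (hN : 1 ≤ N) (hr : 1 ≤ r)
    (hp : 0 < p) (hΔ : 0 < Δ) :
    ∃ (s : ℕ) (t : ℝ), 1 ≤ s ∧ s ≤ r ∧ 0 < t ∧ t ^ 2 ≤ (M : ℝ) / N ∧
      (s : ℝ) ^ (1 / p) * t ≤ Δ ∧ rate M N r p Δ / 2 ≤ s * t ^ 2 := by
  have hM' : (0 : ℝ) < M := by exact_mod_cast hM
  have hN' : (0 : ℝ) < N := by exact_mod_cast hN
  have hq : (0 : ℝ) < (M : ℝ) / N := by positivity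
  set q := (M : ℝ) / N with hqdef
  -- If the cap `√q` on `t` is affordable, take `t = √q`; the constraint then reads `s ≤ x ^ p`.
  -- Otherwise `s = 1` and `t = Δ`.
  by_cases hx : √q ≤ Δ
  · have hsq : 0 < √q := Real.sqrt_pos.mpr hq
    set x := Δ / √q with hxdef
    have hx1 : 1 ≤ x := (one_le_div hsq).mpr hx
    have hx0 : 0 < x := one_pos.trans_le hx1
    have hxp : 1 ≤ x ^ p := Real.one_le_rpow hx1 hp.le
    have hfl : 1 ≤ ⌊x ^ p⌋₊ := Nat.le_floor (by exact_mod_cast hxp)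
    have hfl' : (1 : ℝ) ≤ ⌊x ^ p⌋₊ := by exact_mod_cast hfl
    have hflle : (⌊x ^ p⌋₊ : ℝ) ≤ x ^ p := Nat.floor_le (by positivity)
    have hfllt : x ^ p < ⌊x ^ p⌋₊ + 1 := Nat.lt_floor_add_one _
    refine ⟨min r ⌊x ^ p⌋₊, √q, le_min hr hfl, min_le_left _ _, hsq, (Real.sq_sqrt hq.le).le,
      ?_, ?_⟩
    · have h1 : ((min r ⌊x ^ p⌋₊ : ℕ) : ℝ) ≤ x ^ p :=
        le_trans (by exact_mod_cast min_le_right _ _) hflle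
      have h2 := Real.rpow_le_rpow (Nat.cast_nonneg _) h1 (by positivity : 0 ≤ 1 / p)
      rw [← Real.rpow_mul hx0.le, mul_one_div_cancel hp.ne', Real.rpow_one] at h2
      calc _ ≤ x * √q := by gcongr
        _ = Δ := div_mul_cancel₀ _ hsq.ne'
    · rw [Real.sq_sqrt hq.le]
      rcases le_total r ⌊x ^ p⌋₊ with h | h
      · rw [min_eq_left h]
        have h1 : rate M N r p Δ ≤ r * M / N := min_le_left _ _
        have h2 : (r : ℝ) * M / N = r * q := by rw [hqdef]; ring
        have h3 : 0 ≤ (r : ℝ) * q := by positivity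
        linarith
      · rw [min_eq_right h]
        have h1 : rate M N r p Δ ≤ Δ ^ p * q ^ (1 - p / 2) :=
          (min_le_right _ _).trans (min_le_left _ _)
        have h2 : Δ ^ p * q ^ (1 - p / 2) = x ^ p * q := by
          rw [hxdef, Real.div_rpow hΔ.le hsq.le, Real.sqrt_eq_rpow, ← Real.rpow_mul hq.le,
            Real.rpow_sub hq, Real.rpow_one, one_div_mul_eq_div]
          ring
        -- A floor that is at least 1 loses at most a factor 2; the constant `2 ^ (2 / p) ≥ 2`
        -- absorbs it later.
        have h3 : x ^ p / 2 ≤ ⌊x ^ p⌋₊ := by linarith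
        have h4 := mul_le_mul_of_nonneg_right h3 hq.le
        linarith
  · refine ⟨1, Δ, le_rfl, hr, hΔ, ?_, by simp, ?_⟩
    · rw [← Real.sq_sqrt hq.le]
      exact pow_le_pow_left₀ hΔ.le (not_le.mp hx).le 2
    · have h1 : rate M N r p Δ ≤ Δ ^ 2 := (min_le_right _ _).trans (min_le_right _ _)
      have h3 : 0 ≤ Δ ^ 2 := by positivity
      push_cast
      linarith

/-! ### The lower bound -/

/-- The hard instance: whatever the estimator, some matrix of the class is estimated badly. The
loss is `‖L (Ahat y - A)‖`, where `L` dominates `√c` times the Frobenius norm on low rank. -/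
lemma exists_matrix_estimated_badly {m T N r : ℕ} {σ ν δ c p Δ α : ℝ}
    {X : Fin N → Matrix (Fin m) (Fin T) ℝ} {Ω : Type*} [MeasurableSpace Ω] (P : Measure Ω)
    {ξ : Fin N → Ω → ℝ} (hN : 1 ≤ N) (hM : 8 ≤ max m T) (hr : 1 ≤ r)
    (hrmT : r ≤ min m T) (hσ : 0 < σ) (hν : 0 < ν) (hδ : 0 < δ) (hind : iIndepFun ξ P)
    (hlaw : ∀ i, HasLaw (ξ i) (gaussianReal 0 (Real.toNNReal (σ ^ 2))) P)
    (hRI : RIUpper X r ν δ) (hp : 0 < p) (hp2 : p ≤ 2) (hΔ : 0 < Δ) (hα : 0 < α) (hα8 : α < 1 / 8)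
    {F : Type*} [NormedAddCommGroup F] [NormedSpace ℝ F] [FiniteDimensional ℝ F]
    (L : Matrix (Fin m) (Fin T) ℝ →ₗ[ℝ] F) (hc : 0 < c)
    (hL : ∀ A : Matrix (Fin m) (Fin T) ℝ, A.rank ≤ r → c * schattenNorm 2 A ^ 2 ≤ ‖L A‖ ^ 2)
    {Ahat : (Fin N → ℝ) → Matrix (Fin m) (Fin T) ℝ} (hest : IsEstimator Ahat) :
    ∃ A ∈ matrixClass m T r p (Δ * ν * σ),
      ENNReal.ofReal (1 - (2 : ℝ) ^ (-(3 / 64) * ((max m T : ℕ) : ℝ))) ≤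
        obsLaw P X ξ A {y | c * (frobConst α δ p ν * σ ^ 2 * rate (max m T) N r p Δ)
          < ‖L (Ahat y - A)‖ ^ 2} := by
  set M := max m T with hMdef
  have hM' : (0 : ℝ) < M := by exact_mod_cast (by omega : 0 < M)
  have hN' : (0 : ℝ) < N := by exact_mod_cast hN
  have hlog : 0 < Real.log 2 := Real.log_pos one_lt_two
  obtain ⟨s, t, hs1, hsr, ht, htq, hst, hrate⟩ :=
    exists_rank_level (M := M) (by omega) hN hr hp hΔ
  have hs0 : (0 : ℝ) < s := by exact_mod_cast hs1
  -- Here `α log 2 / 4` is `32 · α log 2 / 128`. The bound `g ≤ σ * ν` serves class membership, the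
  -- value of `g ^ 2` both the separation and the likelihood bound.
  obtain ⟨g, hg0, hg1, hg2⟩ : ∃ g : ℝ, 0 < g ∧ g ≤ σ * ν ∧
      g ^ 2 = α * Real.log 2 / 4 / (1 + δ) ^ 2 * (σ * ν) ^ 2 := by
    refine ⟨√(α * Real.log 2 / 4) / (1 + δ) * (σ * ν), by positivity, ?_, ?_⟩
    · refine mul_le_of_le_one_left (by positivity) ?_
      have hlog1 : Real.log 2 ≤ 1 := (Real.log_le_sub_one_of_pos two_pos).trans (by norm_num)
      have h1 : √(α * Real.log 2 / 4) ≤ 1 := by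
        rw [Real.sqrt_le_one]
        have := mul_le_mul hα8.le hlog1 hlog.le (by norm_num)
        linarith
      rw [div_le_one (by positivity)]
      linarith
    · rw [mul_pow, div_pow, Real.sq_sqrt (by positivity)]
  obtain ⟨a, ha0, ha2⟩ : ∃ a : ℝ, 0 < a ∧ a ^ 2 * M = g ^ 2 * t ^ 2 := by
    refine ⟨g * t / √M, by positivity, ?_⟩
    rw [div_pow, Real.sq_sqrt hM'.le, mul_pow, div_mul_cancel₀ _ hM'.ne']
  obtain ⟨J, hJcard, hJrank⟩ := exists_block (hsr.trans hrmT)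
  have hd : (J.card : ℝ) = s * M := by rw [hJcard, Nat.cast_mul]
  have hrank : ∀ S U : Finset (Fin m × Fin T), S ⊆ J → U ⊆ J →
      (patternMatrix a S - patternMatrix a U).rank ≤ s := by
    intro S U hS hU
    refine hJrank _ fun i j hij => ?_
    have h1 : (i, j) ∉ S := fun h => hij (hS h)
    have h2 : (i, j) ∉ U := fun h => hij (hU h)
    simp [patternMatrix, h1, h2]
  have hrank0 : ∀ S ⊆ J, (patternMatrix a S).rank ≤ s := by
    intro S hS
    have h := hrank S ∅ hS (Finset.empty_subset _)
    rwa [patternMatrix_empty, sub_zero] at h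
  have hfrob : ∀ S ⊆ J, schattenNorm 2 (patternMatrix a S) ^ 2 ≤ a ^ 2 * J.card := by
    intro S hS
    rw [schattenNorm_two_sq_patternMatrix]
    have : (S.card : ℝ) ≤ J.card := by exact_mod_cast Finset.card_le_card hS
    gcongr
  have had : a ^ 2 * J.card = s * (g ^ 2 * t ^ 2) := by rw [hd, ← ha2]; ring
  have hclass : ∀ S ⊆ J, patternMatrix a S ∈ matrixClass m T r p (Δ * ν * σ) := by
    intro S hS
    refine ⟨(hrank0 S hS).trans hsr, ?_⟩
    have h1 : schattenNorm 2 (patternMatrix a S) ≤ (s : ℝ) ^ (1 / 2 : ℝ) * (g * t) := by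
      refine le_of_sq_le_sq ((hfrob S hS).trans_eq ?_) (by positivity)
      rw [had, ← Real.sqrt_eq_rpow, mul_pow, Real.sq_sqrt hs0.le, mul_pow]
    calc _ ≤ (s : ℝ) ^ (1 / p - 1 / 2) * schattenNorm 2 (patternMatrix a S) :=
          schattenNorm_le_of_rank_le hp hp2 _ (hrank0 S hS)
      _ ≤ (s : ℝ) ^ (1 / p - 1 / 2) * ((s : ℝ) ^ (1 / 2 : ℝ) * (g * t)) := by gcongr
      _ = ((s : ℝ) ^ (1 / p) * t) * g := by
          rw [← mul_assoc, ← Real.rpow_add hs0, sub_add_cancel]; ring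
      _ ≤ Δ * (σ * ν) := by gcongr
      _ = Δ * ν * σ := by ring
  have hrate0 : 0 ≤ rate M N r p Δ := by unfold rate; positivity
  have hthr : 32 * (frobConst α δ p ν * σ ^ 2 * rate M N r p Δ) ≤ a ^ 2 * J.card := by
    have h2p : (2 : ℝ) ≤ 2 ^ (2 / p) := by
      conv_lhs => rw [← Real.rpow_one 2]
      exact Real.rpow_le_rpow_of_exponent_le one_le_two ((one_le_div hp).mpr hp2)
    have hfc : 32 * (frobConst α δ p ν * σ ^ 2 * rate M N r p Δ)
        = g ^ 2 * (rate M N r p Δ / 2 ^ (2 / p)) := by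
      rw [hg2, frobConst]
      field_simp
      ring
    rw [hfc, had]
    calc g ^ 2 * (rate M N r p Δ / 2 ^ (2 / p)) ≤ g ^ 2 * (rate M N r p Δ / 2) := by gcongr
      _ ≤ g ^ 2 * (s * t ^ 2) := by gcongr
      _ = _ := by ring
  set thr := c * (frobConst α δ p ν * σ ^ 2 * rate M N r p Δ) with hthrdef
  have hthr0 : 0 ≤ thr := by
    have : 0 ≤ frobConst α δ p ν := by unfold frobConst; positivity
    positivity
  set G : Finset (Fin m × Fin T) → Set (Fin N → ℝ) :=
    fun S => {y | ‖L (Ahat y - patternMatrix a S)‖ ^ 2 ≤ thr} with hG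
  have hGmeas : ∀ S, MeasurableSet (G S) := fun S =>
    measurableSet_le ((hest.measurable_norm L _).pow_const 2) measurable_const
  have hclose : ∀ y, ∀ S ⊆ J, ∀ U ⊆ J, y ∈ G S → y ∈ G U →
      8 * (symmDiff S U).card ≤ J.card := by
    intro y S hS U hU hyS hyU
    have h1 : ‖L (Ahat y - patternMatrix a S)‖ ≤ √thr := Real.le_sqrt_of_sq_le hyS
    have h2 : ‖L (Ahat y - patternMatrix a U)‖ ≤ √thr := Real.le_sqrt_of_sq_le hyU
    have h3 : ‖L (patternMatrix a S - patternMatrix a U)‖ ≤ 2 * √thr := by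
      have : patternMatrix a S - patternMatrix a U
          = (Ahat y - patternMatrix a U) - (Ahat y - patternMatrix a S) := by abel
      rw [this, map_sub]
      exact (norm_sub_le _ _).trans (by linarith)
    have h4 : ‖L (patternMatrix a S - patternMatrix a U)‖ ^ 2 ≤ 4 * thr := by
      calc _ ≤ (2 * √thr) ^ 2 := pow_le_pow_left₀ (norm_nonneg _) h3 2
        _ = 4 * thr := by rw [mul_pow, Real.sq_sqrt hthr0]; norm_num
    have h5 := (hL _ ((hrank S U hS hU).trans hsr)).trans h4
    rw [schattenNorm_two_sq_patternMatrix_sub, hthrdef] at h5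
    have h6 : a ^ 2 * (symmDiff S U).card
        ≤ 4 * (frobConst α δ p ν * σ ^ 2 * rate M N r p Δ) := by
      refine le_of_mul_le_mul_left ?_ hc
      linarith
    -- The triangle inequality cost a factor 4, and `8 · 4 = 32` is the factor in `hthr`.
    have h7 : a ^ 2 * (8 * (symmDiff S U).card : ℝ) ≤ a ^ 2 * J.card := by linarith
    have h8 := le_of_mul_le_mul_left h7 (by positivity)
    exact_mod_cast h8
  have hV : ∀ y, ∑ S ∈ J.powerset, (G S).indicator (1 : (Fin N → ℝ) → ℝ) y
      ≤ (2 : ℝ) ^ (7 / 8 * (J.card : ℝ)) := by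
    classical
    intro y
    have hcount : ∑ S ∈ J.powerset, (G S).indicator (1 : (Fin N → ℝ) → ℝ) y
        = ((J.powerset.filter fun S => y ∈ G S).card : ℝ) := by
      simp [Set.indicator_apply]
    rw [hcount]
    rcases (J.powerset.filter fun S => y ∈ G S).eq_empty_or_nonempty with he | ⟨S, hS⟩
    · rw [he, Finset.card_empty, Nat.cast_zero]
      positivity
    · rw [Finset.mem_filter, Finset.mem_powerset] at hS
      -- Any good pattern serves as centre of a Hamming ball containing all the others.
      refine le_trans ?_ (card_symmDiff_ball_le J S hS.1)
      refine Nat.cast_le.mpr (Finset.card_le_card fun U hU => ?_)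
      rw [Finset.mem_filter, Finset.mem_powerset] at hU ⊢
      exact ⟨hU.1, hclose y S hS.1 U hU.1 hS.2 hU.2⟩
  have := isProbabilityMeasure_obsLaw P X hind hlaw
  obtain ⟨S, hSJ, hQ⟩ := exists_measureReal_mul_card_le (obsLaw P X ξ 0)
    (Finset.powerset_nonempty J) G (fun S _ => hGmeas S) hV
  rw [Finset.mem_powerset] at hSJ
  refine ⟨_, hclass S hSJ, ?_⟩
  set A := patternMatrix a S with hA
  have hQ' : (obsLaw P X ξ 0).real (G S) ≤ (2 : ℝ) ^ (-(1 / 8) * (J.card : ℝ)) := by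
    rw [Finset.card_powerset, Nat.cast_pow, Nat.cast_ofNat, ← Real.rpow_natCast,
      ← le_div_iff₀ (by positivity), ← Real.rpow_sub two_pos] at hQ
    refine hQ.trans_eq ?_
    congr 1
    ring
  have hexp : Real.exp (N * ‖samplingOperator X A‖ ^ 2 / σ ^ 2)
      ≤ (2 : ℝ) ^ (1 / 32 * (J.card : ℝ)) := by
    have h1 : (ν * ‖samplingOperator X A‖) ^ 2 ≤ ((1 + δ) * schattenNorm 2 A) ^ 2 :=
      pow_le_pow_left₀ (by positivity) (hRI A ((hrank0 S hSJ).trans hsr)) 2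
    rw [mul_pow, mul_pow] at h1
    have h2 : ν ^ 2 * ‖samplingOperator X A‖ ^ 2 ≤ (1 + δ) ^ 2 * (s * (g ^ 2 * (M / N))) := by
      refine h1.trans ?_
      gcongr
      refine (hfrob S hSJ).trans ?_
      rw [had]
      gcongr
    have h3 : (1 + δ) ^ 2 * (s * (g ^ 2 * (M / N)))
        = ν ^ 2 * (σ ^ 2 / N * (α * Real.log 2 / 4 * J.card)) := by
      rw [hg2, hd]
      field_simp
    rw [h3] at h2
    have h4 := le_of_mul_le_mul_left h2 (by positivity)
    have h5 : N * ‖samplingOperator X A‖ ^ 2 / σ ^ 2 ≤ α * Real.log 2 / 4 * J.card := by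
      rw [div_le_iff₀ (by positivity)]
      calc N * ‖samplingOperator X A‖ ^ 2
          ≤ N * (σ ^ 2 / N * (α * Real.log 2 / 4 * J.card)) := by gcongr
        _ = _ := by field_simp
    rw [Real.rpow_def_of_pos two_pos]
    refine Real.exp_le_exp.mpr (h5.trans ?_)
    -- With `α < 1/8`, the coefficient `α log 2 / 4` is at most `log 2 / 32`.
    have h6 : 0 ≤ Real.log 2 * J.card := by positivity
    have h7 := mul_le_mul_of_nonneg_right hα8.le h6
    linarith
  have hsq : (obsLaw P X ξ A).real (G S) ^ 2
      ≤ Real.exp (N * ‖samplingOperator X A‖ ^ 2 / σ ^ 2) * (obsLaw P X ξ 0).real (G S) := by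
    have h := ENNReal.toReal_mono (ENNReal.mul_ne_top ENNReal.ofReal_ne_top (measure_ne_top _ _))
      (obsLaw_sq_le P X hN hσ hind hlaw A (hGmeas S))
    rwa [ENNReal.toReal_pow, ENNReal.toReal_mul, ENNReal.toReal_ofReal (Real.exp_pos _).le] at h
  have hgood : (obsLaw P X ξ A).real (G S) ≤ (2 : ℝ) ^ (-(3 / 64) * (M : ℝ)) := by
    -- The exponent is half of `1/32 - 1/8`.
    have h1 : (obsLaw P X ξ A).real (G S) ≤ (2 : ℝ) ^ (-(3 / 64) * (J.card : ℝ)) := by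
      refine le_of_sq_le_sq ?_ (by positivity)
      calc _ ≤ (2 : ℝ) ^ (1 / 32 * (J.card : ℝ)) * (2 : ℝ) ^ (-(1 / 8) * (J.card : ℝ)) :=
            hsq.trans (by gcongr)
        _ = _ := by
            rw [← Real.rpow_add two_pos, ← Real.rpow_natCast, ← Real.rpow_mul two_pos.le]
            congr 1
            push_cast
            ring
    refine h1.trans (Real.rpow_le_rpow_of_exponent_le one_le_two ?_)
    have hs1' : (1 : ℝ) ≤ s := by exact_mod_cast hs1
    have hdM : (M : ℝ) ≤ J.card := by
      rw [hd]
      exact le_mul_of_one_le_left hM'.le hs1'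
    linarith
  have hcompl : {y | thr < ‖L (Ahat y - A)‖ ^ 2} = (G S)ᶜ := by
    ext y
    simp [hG, hA]
  rw [hcompl, ENNReal.ofReal_le_iff_le_toReal (measure_ne_top _ _)]
  change _ ≤ (obsLaw P X ξ A).real (G S)ᶜ
  rw [probReal_compl_eq_one_sub (hGmeas S)]
  linarith

/-! ### The two losses and the theorem -/

/-- The vectorization of matrices, an isometry for the Frobenius norm. -/
noncomputable def vectorize (m T : ℕ) :
    Matrix (Fin m) (Fin T) ℝ →ₗ[ℝ] EuclideanSpace ℝ (Fin m × Fin T) where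
  toFun A := WithLp.toLp 2 fun x => A x.1 x.2
  map_add' _ _ := rfl
  map_smul' _ _ := rfl

lemma norm_vectorize_sq {m T : ℕ} (A : Matrix (Fin m) (Fin T) ℝ) :
    ‖vectorize m T A‖ ^ 2 = schattenNorm 2 A ^ 2 := by
  rw [schattenNorm_two_sq, EuclideanSpace.real_norm_sq_eq, Fintype.sum_prod_type]
  rfl

end TraceRegression

theorem theorem5 :
    ∃ β : ℕ → ℝ → ℝ,
      (∀ (M : ℕ) (α : ℝ), 8 ≤ M → 0 < α → α < 1 / 8 → 0 < β M α) ∧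
      Tendsto (fun x : ℕ × ℝ => β x.1 x.2) (atTop ×ˢ 𝓝[>] (0 : ℝ)) (𝓝 1) ∧
      ∀ (m T N r : ℕ) (σ ν δ : ℝ) (X : Fin N → Matrix (Fin m) (Fin T) ℝ)
        (Ω : Type*) [MeasurableSpace Ω] (P : Measure Ω) [IsProbabilityMeasure P]
        (ξ : Fin N → Ω → ℝ),
        1 ≤ N → 8 ≤ max m T → 1 ≤ r → r ≤ min m T →
        0 < σ → 0 < ν → 0 < δ → δ < 1 →
        iIndepFun ξ P →
        (∀ i, HasLaw (ξ i) (gaussianReal 0 (Real.toNNReal (σ ^ 2))) P) →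
        (TraceRegression.RIUpper X r ν δ →
          ∀ p Δ α : ℝ, 0 < p → p ≤ 2 → 0 < Δ → 0 < α → α < 1 / 8 →
            ENNReal.ofReal (β (max m T) α) ≤
              ⨅ (Ahat : (Fin N → ℝ) → Matrix (Fin m) (Fin T) ℝ)
                (_ : TraceRegression.IsEstimator Ahat),
              ⨆ A ∈ TraceRegression.matrixClass m T r p (Δ * ν * σ),
                TraceRegression.obsLaw P X ξ A
                  {y | TraceRegression.frobConst α δ p ν * σ ^ 2
                        * TraceRegression.rate (max m T) N r p Δ
                      < TraceRegression.schattenNorm 2 (Ahat y - A) ^ 2}) ∧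
        (TraceRegression.RI X r ν δ →
          ∀ p Δ α : ℝ, 0 < p → p ≤ 2 → 0 < Δ → 0 < α → α < 1 / 8 →
            ENNReal.ofReal (β (max m T) α) ≤
              ⨅ (Ahat : (Fin N → ℝ) → Matrix (Fin m) (Fin T) ℝ)
                (_ : TraceRegression.IsEstimator Ahat),
              ⨆ A ∈ TraceRegression.matrixClass m T r p (Δ * ν * σ),
                TraceRegression.obsLaw P X ξ A
                  {y | TraceRegression.predConst α δ p * σ ^ 2
                        * TraceRegression.rate (max m T) N r p Δ
                      < TraceRegression.predictionDist X (Ahat y) A ^ 2}) := by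
  refine ⟨fun M _ => 1 - (2 : ℝ) ^ (-(3 / 64) * (M : ℝ)), fun M α hM _ _ => ?_, ?_, ?_⟩
  · have hM' : (8 : ℝ) ≤ M := by exact_mod_cast hM
    exact sub_pos.mpr (Real.rpow_lt_one_of_one_lt_of_neg one_lt_two (by linarith))
  · have h : Tendsto (fun M : ℕ => 1 - (2 : ℝ) ^ (-(3 / 64) * (M : ℝ))) atTop (𝓝 (1 - 0)) := by
      refine tendsto_const_nhds.sub ?_
      have hb : (2 : ℝ) ^ (-(3 / 64) : ℝ) < 1 :=
        Real.rpow_lt_one_of_one_lt_of_neg one_lt_two (by norm_num)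
      refine (tendsto_pow_atTop_nhds_zero_of_lt_one (by positivity) hb).congr fun M => ?_
      rw [Real.rpow_mul two_pos.le, Real.rpow_natCast]
    rw [sub_zero] at h
    exact h.comp tendsto_fst
  · intro m T N r σ ν δ X Ω _ P _ ξ hN hM hr hrmT hσ hν hδ hδ1 hind hlaw
    refine ⟨fun hRI p Δ α hp hp2 hΔ hα hα8 => ?_, fun hRI p Δ α hp hp2 hΔ hα hα8 => ?_⟩
    · refine le_iInf₂ fun Ahat hest => ?_
      obtain ⟨A, hA, h⟩ := TraceRegression.exists_matrix_estimated_badly P hN hM hr hrmT hσ hν hδ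
        hind hlaw hRI hp hp2 hΔ hα hα8 (TraceRegression.vectorize m T) one_pos
        (fun A _ => by rw [TraceRegression.norm_vectorize_sq, one_mul]) hest
      simp_rw [TraceRegression.norm_vectorize_sq, one_mul] at h
      exact h.trans (le_iSup₂_of_le A hA le_rfl)
    · refine le_iInf₂ fun Ahat hest => ?_
      -- This `c` comes from squaring the left isometry inequality; it turns `frobConst` into
      -- `predConst`.
      obtain ⟨A, hA, h⟩ := TraceRegression.exists_matrix_estimated_badly P hN hM hr hrmT hσ hν hδ
        hind hlaw hRI.2 hp hp2 hΔ hα hα8 (TraceRegression.samplingOperator X)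
        (c := (1 - δ) ^ 2 / ν ^ 2) (div_pos (pow_pos (by linarith) 2) (by positivity))
        (fun A hA => by
          have h := pow_le_pow_left₀ (mul_nonneg (by linarith)
            (TraceRegression.schattenNorm_nonneg 2 A)) (hRI.1 A hA) 2
          rw [mul_pow, mul_pow] at h
          rw [div_mul_eq_mul_div, div_le_iff₀ (by positivity)]
          linarith) hest
      have hconst : (1 - δ) ^ 2 / ν ^ 2 * (TraceRegression.frobConst α δ p ν * σ ^ 2
            * TraceRegression.rate (max m T) N r p Δ)
          = TraceRegression.predConst α δ p * σ ^ 2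
            * TraceRegression.rate (max m T) N r p Δ := by
        rw [TraceRegression.frobConst, TraceRegression.predConst]
        field_simp
      rw [hconst] at h
      exact h.trans (le_iSup₂_of_le A hA le_rfl)
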